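/- Let $n\ge 2$, let $\mathbb B^n$ be the open unit ball of $\mathbb C^n$ with closure $\overline{\mathbb B^n}$, let $\mathbb S^n=\partial\mathbb B^n=\{z\in\mathbb C^n:|z|=1\}$, let $\sigma$ be the rotation-invariant Borel probability measure on $\mathbb S^n$, and let $\mathbb 1=(1,0,\dots,0)$. For $u,v\in\mathbb S^n$ put $\langle u,v\rangle=\sum_j u_j\overline{v_j}$ and $d(u,v)=|1-\langle u,v\rangle|$. A nonisotropic ball of radius $l(Q)=r>0$ is a set $Q=\{z\in\mathbb S^n: d(z,\xi)\le r\}$ with $\xi\in\mathbb S^n$. The mean oscillation of a continuous function $f:\mathbb S^n\to\mathbb C$ on $Q$ is $$\nu(f,Q)=\inf_{a\in\mathbb C}\frac1{\sigma(Q)}\int_Q|f-a|\,d\sigma .$$ For every function $f:\overline{\mathbb B^n}\to\mathbb C$ that is continuous, and holomorphic and zero-free in $\mathbb B^n$, the slice constant $$B(f)=\sup_{\xi\in\mathbb S^n}\int_{-\pi}^{\pi}\bigl|\log|f(e^{i\theta}\xi)|\bigr|\,d\theta$$ is finite (with $|\log 0|=\infty$). Moreover, let $\alpha\in(0,1)$.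 For all $B_0\ge 0$ and $C_0$ there is a constant $C$, depending only on $B_0$, $C_0$, $\alpha$ and $n$, such that the following holds. Let $f:\overline{\mathbb B^n}\to\mathbb C$ be continuous, and holomorphic and zero-free in $\mathbb B^n$, with $B(f)\le B_0$ and $$\bigl||f(t)|-|f(\mathbb 1)|\bigr|\le C_0\,d(t,\mathbb 1)^\alpha\qquad\text{for all } t\in\mathbb S^n .$$ Then $$\nu(f,Q)\le C\,l(Q)^{\alpha/2}$$ for every nonisotropic ball $Q$ of radius $l(Q)>0$ that contains $\mathbb 1$. -/

import Mathlib

open MeasureTheory Metric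
open scoped ENNReal NNReal

noncomputable section

/-- The space `ℂⁿ` with its Euclidean norm. -/
abbrev Cn (n : ℕ) : Type := EuclideanSpace ℂ (Fin n)

/-- The unit sphere of `ℂⁿ`, that is, the boundary of the unit ball. -/
abbrev CSphere (n : ℕ) : Type := sphere (0 : Cn n) 1

/-- The point `(1, 0, …, 0)` of the unit sphere. -/
def basePoint (n : ℕ) [NeZero n] : CSphere n :=
  ⟨EuclideanSpace.single 0 1, by simp⟩

/-- The rotation-invariant Borel probability measure on the unit sphere of `ℂⁿ`: the surface
measure (Mathlib's `Measure.toSphere` of Lebesgue measure) divided by its total mass. -/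
def sphereMeasure (n : ℕ) : Measure (CSphere n) :=
  ((volume : Measure (Cn n)).toSphere Set.univ)⁻¹ • (volume : Measure (Cn n)).toSphere

/-- The nonisotropic quasimetric `d(u, v) = |1 - ⟨u, v⟩|`, where `⟨u, v⟩ = ∑ uⱼ conj(vⱼ)`
(Mathlib's `inner` is conjugate-linear in its first argument). -/
def nonisoDist {n : ℕ} (u v : CSphere n) : ℝ :=
  ‖1 - inner ℂ (v : Cn n) (u : Cn n)‖

/-- The nonisotropic ball with centre `ξ` and radius `r`. -/
def nonisoBall {n : ℕ} (ξ : CSphere n) (r : ℝ) : Set (CSphere n) :=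
  {z | nonisoDist z ξ ≤ r}

/-- The mean oscillation `ν(f, Q)`: the infimum over `a ∈ ℂ` of the average of `|f - a|` over `Q`
with respect to the normalized surface measure. -/
def meanOsc {n : ℕ} (f : CSphere n → ℂ) (Q : Set (CSphere n)) : ℝ :=
  ⨅ a : ℂ, ⨍ z in Q, ‖f z - a‖ ∂(sphereMeasure n)

/-- The slice constant: the supremum over `ξ` in the unit sphere of the integral of
`|log |f(λ ξ)||` over the unit circle `λ = exp(i θ)`. The integrand takes its values
in `[0, ∞]`, and it equals `∞` where `f` vanishes. -/
def sliceConst {n : ℕ} (f : Cn n → ℂ) : ℝ≥0∞ :=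
  ⨆ ξ : CSphere n, ∫⁻ θ in Set.Ioc (-Real.pi) Real.pi,
    (ENNReal.log ‖f (Complex.exp (θ * Complex.I) • (ξ : Cn n))‖ₑ).abs

/-- `f` is holomorphic and zero-free in the open unit ball of `ℂⁿ` and continuous on the closed
unit ball. -/
structure IsZeroFreeBallFunction {n : ℕ} (f : Cn n → ℂ) : Prop where
  holomorphic : DifferentiableOn ℂ f (ball 0 1)
  continuous : ContinuousOn f (closedBall 0 1)
  ne_zero : ∀ z ∈ ball (0 : Cn n) 1, f z ≠ 0

end

/-! The gain comes from a fact about discs. If g is zero-free in a disc with centre c and |g| is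
within η of m on the circle, the maximum principle for g and 1/g gives |g(c)| ≥ m - η. The mean of
|g - g(c)|² over the circle equals the mean of |g|² minus |g(c)|², hence is at most 4η(m + η). The
square root turns a modulus error of order r^α into an oscillation κ of order r^(α/2)
(`circleAverage_norm_sub_le`), and Cauchy's formula bounds the derivative at the centre by κ/R
(`norm_deriv_center_le`).

Let Q be a ball of radius r containing e = `basePoint n`, and v a unit vector at distance O(r) from
e. Through each z in Q passes a disc centred on the line ℂv, contained in a complex line orthogonal
to v, with its boundary circle on the sphere. The distance to v is constant on that circle, so the
circle stays within O(r) of e, where |f| is nearly constant. Averaging the disc estimate over these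
circles compares f in the mean with its values at the centres
(`lintegral_enorm_sub_orthScale_zero_le`). On the centres |f| is again within η of m, so the
derivative bound, on discs in ℂv of radius comparable to r, shows that these values differ by O(κ)
(`norm_sub_smul_le`). Such discs fit only if the centres keep a distance of order r from the unit
circle, which is why v is tilted away from e (`exists_tilted_axis`). Doubling
(`exists_measure_nonisoBall_le`) compares the union of the circles with Q.

The slice constant serves only to bound |f(e)|; its finiteness is Jensen's formula together with
Fatou's lemma. -/

/-! ### Zero-free functions of nearly constant modulus on a circle -/

section Disc

variable {g : ℂ → ℂ} {c : ℂ} {R m η κ : ℝ}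

/-- Maximum and minimum principle for a zero-free function. -/
theorem norm_mem_Icc_of_sphere (hR : 0 < R) (hg : DiffContOnCl ℂ g (ball c R))
    (h0 : ∀ z ∈ ball c R, g z ≠ 0) (hm : ∀ z ∈ sphere c R, |‖g z‖ - m| ≤ η) {z : ℂ}
    (hz : z ∈ closedBall c R) : m - η ≤ ‖g z‖ ∧ ‖g z‖ ≤ m + η := by
  have hfr : frontier (ball c R) = sphere c R := frontier_ball c hR.ne'
  have hcl : closure (ball c R) = closedBall c R := closure_ball c hR.ne'
  refine ⟨?_, Complex.norm_le_of_forall_mem_frontier_norm_le isBounded_ball hg ?_ (hcl ▸ hz)⟩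
  · by_cases hpos : m - η ≤ 0
    · exact hpos.trans (norm_nonneg _)
    push Not at hpos
    have hs : ∀ w ∈ sphere c R, m - η ≤ ‖g w‖ := fun w hw => by
      have := (abs_le.1 (hm w hw)).1
      linarith
    -- The positive lower bound excludes zeros on the circle too, so the maximum principle applies
    -- to 1/g.
    have hne : ∀ w ∈ closure (ball c R), g w ≠ 0 := by
      intro w hw
      rw [hcl] at hw
      rcases (mem_closedBall.1 hw).lt_or_eq with h | h
      · exact h0 w h
      · exact norm_pos_iff.1 (hpos.trans_le (hs w h))
    have := Complex.norm_le_of_forall_mem_frontier_norm_le (C := (m - η)⁻¹) isBounded_ball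
      (hg.inv hne) (fun w hw => ?_) (hcl ▸ hz)
    · rw [Pi.inv_apply, norm_inv] at this
      exact (inv_le_inv₀ (norm_pos_iff.2 (hne z (hcl ▸ hz))) hpos).1 this
    · rw [Pi.inv_apply, norm_inv]
      exact inv_anti₀ hpos (hs w (hfr ▸ hw))
  · intro w hw
    have := (abs_le.1 (hm w (hfr ▸ hw))).2
    linarith

/-- For m ≥ η the lower bound m - η at the centre leaves 4mη; for m ≤ η already (m + η)² ≤ 2η(m +
η). -/
theorem sq_sub_sq_norm_center_le (hR : 0 < R) (hg : DiffContOnCl ℂ g (ball c R))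
    (h0 : ∀ z ∈ ball c R, g z ≠ 0) (hm : ∀ z ∈ sphere c R, |‖g z‖ - m| ≤ η) (hm0 : 0 ≤ m)
    (hη : 0 ≤ η) : (m + η) ^ 2 - ‖g c‖ ^ 2 ≤ 4 * η * (m + η) := by
  obtain ⟨h1, h2⟩ := norm_mem_Icc_of_sphere hR hg h0 hm (mem_closedBall_self hR.le)
  rcases le_total m η with h | h
  · nlinarith [norm_nonneg (g c)]
  · nlinarith [norm_nonneg (g c)]

theorem DiffContOnCl.circleIntegrable (hR : 0 < R) (hg : DiffContOnCl ℂ g (ball c R)) :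
    CircleIntegrable g c R :=
  (hg.continuousOn_ball.mono sphere_subset_closedBall).circleIntegrable hR.le

/-- If the modulus of a zero-free function is nearly constant on a circle, then the function is
nearly constant in the mean on that circle. -/
theorem circleAverage_norm_sub_le (hR : 0 < R) (hg : DiffContOnCl ℂ g (ball c R))
    (h0 : ∀ z ∈ ball c R, g z ≠ 0) (hm : ∀ z ∈ sphere c R, |‖g z‖ - m| ≤ η) (hm0 : 0 ≤ m)
    (hη : 0 ≤ η) (hκ : 0 < κ) (hκ' : 4 * η * (m + η) ≤ κ ^ 2) :
    Real.circleAverage (fun z => ‖g z - g c‖) c R ≤ κ := by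
  have hgc : ContinuousOn g (sphere c |R|) := by
    rw [abs_of_pos hR]
    exact hg.continuousOn_ball.mono sphere_subset_closedBall
  -- The cross term of |g - g(c)|²; by the mean value property its average is |g(c)|².
  let L : ℂ →L[ℝ] ℝ := Complex.reCLM ∘L ((starRingEnd ℂ (g c)) • (ContinuousLinearMap.id ℝ ℂ))
  have hL : ∀ w, L w = (starRingEnd ℂ (g c) * w).re := fun w => rfl
  have hLc : L (g c) = ‖g c‖ ^ 2 := by
    rw [hL, ← Complex.normSq_eq_conj_mul_self, Complex.ofReal_re, Complex.normSq_eq_norm_sq]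
  have hint : CircleIntegrable (fun z => L (g z)) c R :=
    (L.continuous.comp_continuousOn hgc).circleIntegrable'
  have havg : Real.circleAverage (fun z => L (g z)) c R = ‖g c‖ ^ 2 := by
    have := L.circleAverage_comp_comm (hg.circleIntegrable hR)
    rw [DiffContOnCl.circleAverage (by rwa [abs_of_pos hR]), hLc] at this
    exact this
  -- The inequality x ≤ (x²/κ + κ)/2 replaces Cauchy–Schwarz and leaves a bound affine in L(g(z)),
  -- whose average is explicit.
  have hpt : ∀ z ∈ sphere c |R|, ‖g z - g c‖ ≤
      (((m + η) ^ 2 + ‖g c‖ ^ 2) / (2 * κ) + κ / 2) - κ⁻¹ * L (g z) := by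
    intro z hz
    rw [abs_of_pos hR] at hz
    have hn := (norm_mem_Icc_of_sphere hR hg h0 hm (sphere_subset_closedBall hz)).2
    have hsq : ‖g z - g c‖ ^ 2 = ‖g z‖ ^ 2 + ‖g c‖ ^ 2 - 2 * L (g z) := by
      rw [hL, ← Complex.normSq_eq_norm_sq, ← Complex.normSq_eq_norm_sq,
        ← Complex.normSq_eq_norm_sq, Complex.normSq_sub, mul_comm (g z)]
    have hle : ‖g z - g c‖ ^ 2 ≤ (m + η) ^ 2 + ‖g c‖ ^ 2 - 2 * L (g z) := by
      nlinarith [norm_nonneg (g z)]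
    have : (((m + η) ^ 2 + ‖g c‖ ^ 2) / (2 * κ) + κ / 2) - κ⁻¹ * L (g z)
        = ((m + η) ^ 2 + ‖g c‖ ^ 2 - 2 * L (g z) + κ ^ 2) / (2 * κ) := by
      field_simp
      ring
    rw [this, le_div_iff₀ (by positivity)]
    nlinarith [sq_nonneg (‖g z - g c‖ - κ)]
  have hint2 : CircleIntegrable (fun z => (((m + η) ^ 2 + ‖g c‖ ^ 2) / (2 * κ) + κ / 2)
      - κ⁻¹ * L (g z)) c R :=
    (continuousOn_const.sub (continuousOn_const.mul
      (L.continuous.comp_continuousOn hgc))).circleIntegrable'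
  have hint1 : CircleIntegrable (fun z => ‖g z - g c‖) c R :=
    (hgc.sub continuousOn_const).norm.circleIntegrable'
  refine (Real.circleAverage_mono hint1 hint2 hpt).trans ?_
  have e1 := Real.circleAverage_fun_sub
    (f₁ := fun _ : ℂ => ((m + η) ^ 2 + ‖g c‖ ^ 2) / (2 * κ) + κ / 2)
    (f₂ := fun z => κ⁻¹ * L (g z)) (circleIntegrable_const _ c R)
    (continuousOn_const.mul (L.continuous.comp_continuousOn hgc)).circleIntegrable'
  have e2 := Real.circleAverage_fun_smul (c := c) (R := R) (a := κ⁻¹) (f := fun z => L (g z))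
  simp only [smul_eq_mul] at e2
  rw [e1, e2, Real.circleAverage_const, havg]
  have h4 := sq_sub_sq_norm_center_le hR hg h0 hm hm0 hη
  have : ((m + η) ^ 2 + ‖g c‖ ^ 2) / (2 * κ) + κ / 2 - κ⁻¹ * ‖g c‖ ^ 2
      = ((m + η) ^ 2 - ‖g c‖ ^ 2 + κ ^ 2) / (2 * κ) := by
    field_simp
    ring
  rw [this, div_le_iff₀ (by positivity)]
  nlinarith

/-- Cauchy's formula is applied to g - g(c), so that the mean oscillation, not the size of g,
controls the derivative. -/
theorem norm_deriv_center_le (hR : 0 < R) (hg : DiffContOnCl ℂ g (ball c R))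
    (h0 : ∀ z ∈ ball c R, g z ≠ 0) (hm : ∀ z ∈ sphere c R, |‖g z‖ - m| ≤ η) (hm0 : 0 ≤ m)
    (hη : 0 ≤ η) (hκ : 0 < κ) (hκ' : 4 * η * (m + η) ≤ κ ^ 2) :
    ‖deriv g c‖ ≤ κ / R := by
  have hF : DiffContOnCl ℂ (fun z => g z - g c) (ball c R) := hg.sub_const (g c)
  have hd : deriv g c = Real.circleAverage (fun z => (z - c)⁻¹ * (g z - g c)) c R := by
    have h := hF.deriv_eq_smul_circleIntegral hR
    rw [deriv_sub_const] at h
    rw [Real.circleAverage_eq_circleIntegral hR.ne', eq_inv_smul_iff₀ Complex.two_pi_I_ne_zero, ← h]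
    congr 1
    ext z
    simp only [smul_eq_mul]
    rw [one_div, sq, mul_inv, mul_assoc]
  have hle := circleAverage_norm_sub_le hR hg h0 hm hm0 hη hκ hκ'
  have hnorm : ‖deriv g c‖ ≤ Real.circleAverage (fun z => R⁻¹ * ‖g z - g c‖) c R := by
    rw [hd, Real.circleAverage, Real.circleAverage, norm_smul, smul_eq_mul, Real.norm_eq_abs,
      abs_of_pos (inv_pos.2 Real.two_pi_pos)]
    refine mul_le_mul_of_nonneg_left ?_ (inv_pos.2 Real.two_pi_pos).le
    refine (intervalIntegral.norm_integral_le_integral_norm Real.two_pi_pos.le).trans (le_of_eq ?_)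
    congr 1
    ext θ
    simp [abs_of_pos hR]
  have e2 := Real.circleAverage_fun_smul (c := c) (R := R) (a := R⁻¹) (f := fun z => ‖g z - g c‖)
  simp only [smul_eq_mul] at e2
  rw [e2] at hnorm
  refine hnorm.trans ?_
  rw [div_eq_inv_mul]
  gcongr

end Disc

/-! ### The nonisotropic quasimetric -/

section Geometry

variable {n : ℕ}

/-- The component of `z` orthogonal to `v`. -/
noncomputable abbrev orthPart (v z : Cn n) : Cn n := z - inner ℂ v z • v

theorem inner_orthPart {v : Cn n} (hv : ‖v‖ = 1) (z : Cn n) : inner ℂ v (orthPart v z) = 0 := by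
  simp [orthPart, inner_self_eq_norm_sq_to_K, hv]

theorem inner_eq_add_inner_orthPart {v : Cn n} (hv : ‖v‖ = 1) (w z : Cn n) :
    inner ℂ w z = inner ℂ v z * starRingEnd ℂ (inner ℂ v w)
      + inner ℂ (orthPart v w) (orthPart v z) := by
  have h := inner_orthPart hv z
  have : inner ℂ (orthPart v w) (orthPart v z) = inner ℂ w (orthPart v z) := by
    rw [inner_sub_left (w) (inner ℂ v w • v), inner_smul_left, h, mul_zero, sub_zero]
  rw [this, inner_conj_symm]
  simp only [orthPart, inner_sub_right, inner_smul_right]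
  ring

theorem norm_sq_add_norm_sq_orthPart {v : Cn n} (hv : ‖v‖ = 1) (z : Cn n) :
    ‖inner ℂ v z‖ ^ 2 + ‖orthPart v z‖ ^ 2 = ‖z‖ ^ 2 := by
  have h := inner_eq_add_inner_orthPart hv z z
  rw [inner_self_eq_norm_sq_to_K, inner_self_eq_norm_sq_to_K, RCLike.mul_conj] at h
  exact_mod_cast h.symm

theorem CSphere.norm_eq (z : CSphere n) : ‖(z : Cn n)‖ = 1 := by simp

theorem CSphere.norm_inner_le_one (v z : CSphere n) : ‖inner ℂ (v : Cn n) (z : Cn n)‖ ≤ 1 := by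
  simpa using norm_inner_le_norm (𝕜 := ℂ) (v : Cn n) (z : Cn n)

/-- Pythagoras and 1 - x² ≤ 2(1 - x). A ball of radius r thus has extent r along its centre but √r
orthogonally to it. -/
theorem norm_sq_orthPart_le (v z : CSphere n) :
    ‖orthPart (v : Cn n) z‖ ^ 2 ≤ 2 * nonisoDist z v := by
  have h := norm_sq_add_norm_sq_orthPart v.norm_eq (z : Cn n)
  have h1 := CSphere.norm_inner_le_one v z
  have h2 : 1 - ‖inner ℂ (v : Cn n) (z : Cn n)‖ ≤ nonisoDist z v := by
    have := norm_sub_norm_le (1 : ℂ) (inner ℂ (v : Cn n) (z : Cn n))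
    rwa [norm_one] at this
  rw [z.norm_eq] at h
  nlinarith [norm_nonneg (inner ℂ (v : Cn n) (z : Cn n))]

theorem nonisoDist_comm (u v : CSphere n) : nonisoDist u v = nonisoDist v u := by
  rw [nonisoDist, nonisoDist, ← RCLike.norm_conj (K := ℂ), map_sub, map_one, inner_conj_symm]

theorem nonisoDist_le_two (u v : CSphere n) : nonisoDist u v ≤ 2 := by
  refine (norm_sub_le _ _).trans ?_
  have := CSphere.norm_inner_le_one v u
  rw [norm_one]
  linarith

theorem nonisoDist_nonneg (u v : CSphere n) : 0 ≤ nonisoDist u v := norm_nonneg _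

/-- The quasi-triangle inequality. -/
theorem nonisoDist_le_two_mul_add (u v w : CSphere n) :
    nonisoDist u w ≤ 2 * (nonisoDist u v + nonisoDist v w) := by
  have hu := norm_sq_orthPart_le v u
  have hw := norm_sq_orthPart_le v w
  rw [nonisoDist_comm w v] at hw
  have hcs := norm_inner_le_norm (𝕜 := ℂ) (orthPart (v : Cn n) w) (orthPart (v : Cn n) u)
  -- Only the last term involves the orthogonal parts; they have size √(2d), and the
  -- arithmetic-geometric mean inequality bounds their product by the sum of the distances.
  have h1 : (1 : ℂ) - inner ℂ (w : Cn n) (u : Cn n) =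
      (1 - inner ℂ (v : Cn n) (u : Cn n)) + inner ℂ (v : Cn n) (u : Cn n) *
        (1 - starRingEnd ℂ (inner ℂ (v : Cn n) (w : Cn n)))
        - inner ℂ (orthPart (v : Cn n) w) (orthPart (v : Cn n) u) := by
    rw [inner_eq_add_inner_orthPart v.norm_eq (w : Cn n) (u : Cn n)]
    ring
  have h2 : ‖(1 : ℂ) - starRingEnd ℂ (inner ℂ (v : Cn n) (w : Cn n))‖ = nonisoDist v w := by
    rw [inner_conj_symm, nonisoDist]
  have h3 : nonisoDist u w ≤ nonisoDist u v + nonisoDist v w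
      + ‖orthPart (v : Cn n) w‖ * ‖orthPart (v : Cn n) u‖ := by
    rw [nonisoDist, h1]
    refine (norm_sub_le _ _).trans (add_le_add ((norm_add_le _ _).trans (add_le_add le_rfl ?_)) hcs)
    rw [norm_mul, h2]
    exact mul_le_of_le_one_left (nonisoDist_nonneg _ _) (CSphere.norm_inner_le_one v u)
  nlinarith [sq_nonneg (‖orthPart (v : Cn n) w‖ - ‖orthPart (v : Cn n) u‖)]

theorem continuous_nonisoDist_left (v : CSphere n) : Continuous fun z => nonisoDist z v := by
  unfold nonisoDist
  fun_prop

theorem measurableSet_nonisoBall (v : CSphere n) (r : ℝ) : MeasurableSet (nonisoBall v r) :=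
  (isClosed_le (continuous_nonisoDist_left v) continuous_const).measurableSet

end Geometry

/-! ### Unitary invariance of the measure -/

section Unitary

variable {n : ℕ}

/-- The action of a unitary map on the sphere. -/
noncomputable def sphereMap (U : Cn n ≃ₗᵢ[ℂ] Cn n) (z : CSphere n) : CSphere n := ⟨U z, by simp⟩

theorem continuous_sphereMap (U : Cn n ≃ₗᵢ[ℂ] Cn n) : Continuous (sphereMap U) :=
  (U.continuous.comp continuous_subtype_val).subtype_mk _

theorem nonisoDist_sphereMap (U : Cn n ≃ₗᵢ[ℂ] Cn n) (u v : CSphere n) :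
    nonisoDist (sphereMap U u) (sphereMap U v) = nonisoDist u v := by
  simp [nonisoDist, sphereMap]

open scoped Pointwise in
-- The surface measure of a set is a multiple of the volume of the cone over it, and a unitary map
-- preserves volume and commutes with forming cones.
theorem measurePreserving_sphereMap (U : Cn n ≃ₗᵢ[ℂ] Cn n) :
    MeasurePreserving (sphereMap U) (sphereMeasure n) (sphereMeasure n) := by
  have hU : MeasurePreserving U (volume : Measure (Cn n)) volume := by
    let U' : Cn n ≃ₗᵢ[ℝ] Cn n := { U.toLinearEquiv.restrictScalars ℝ with norm_map' := U.norm_map }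
    exact U'.measurePreserving
  refine MeasurePreserving.smul_measure ⟨(continuous_sphereMap U).measurable, ?_⟩ _
  ext s hs
  have hs' := (continuous_sphereMap U).measurable hs
  rw [Measure.map_apply (continuous_sphereMap U).measurable hs, Measure.toSphere_apply' _ hs,
    Measure.toSphere_apply' _ hs']
  congr 1
  rw [← hU.measure_preimage_emb U.toHomeomorph.measurableEmbedding
    (Set.Ioo (0 : ℝ) 1 • (Subtype.val '' s))]
  congr 1
  ext x
  simp only [Set.mem_smul, Set.mem_image, Set.mem_preimage]
  constructor
  · rintro ⟨t, ht, _, ⟨z, hz, rfl⟩, rfl⟩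
    exact ⟨t, ht, sphereMap U z, ⟨_, hz, rfl⟩, (U.toLinearEquiv.map_smul_of_tower t (z : Cn n)).symm⟩
  · rintro ⟨t, ht, _, ⟨z, hz, rfl⟩, hx⟩
    have hz' : sphereMap U (sphereMap U.symm z) = z := Subtype.ext (U.apply_symm_apply _)
    refine ⟨t, ht, _, ⟨sphereMap U.symm z, by rwa [hz'], rfl⟩, U.injective ?_⟩
    rw [← hx]
    refine (U.toLinearEquiv.map_smul_of_tower t _).trans ?_
    exact congrArg (fun w : CSphere n => t • (w : Cn n)) hz'

instance : IsFiniteMeasure (sphereMeasure n) := by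
  -- The zero case occurs for n = 0, where the sphere is empty and the normalizing factor is ∞.
  rcases eq_or_ne (volume : Measure (Cn n)).toSphere 0 with h | h
  · rw [sphereMeasure, h, smul_zero]
    infer_instance
  · refine ⟨?_⟩
    rw [sphereMeasure, Measure.smul_apply, smul_eq_mul, ENNReal.inv_mul_cancel
      (Measure.measure_univ_ne_zero.2 h) (measure_ne_top _ _)]
    exact ENNReal.one_lt_top

/-- The isometry between the lines ℂu and ℂv extends to the whole space. -/
theorem exists_sphereMap_eq (u v : CSphere n) : ∃ U : Cn n ≃ₗᵢ[ℂ] Cn n, sphereMap U u = v := by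
  let e := LinearIsometryEquiv.toSpanUnitSingleton (𝕜 := ℂ) (u : Cn n) u.norm_eq
  let L := (LinearIsometry.toSpanSingleton ℂ (Cn n) v.norm_eq).comp e.symm.toLinearIsometry
  refine ⟨L.extend.toLinearIsometryEquiv rfl, Subtype.ext ?_⟩
  have h1 : ((e 1 : Submodule.span ℂ {(u : Cn n)}) : Cn n) = u := by simp [e]
  have h2 : L.extend (e 1 : Cn n) = v := by
    rw [LinearIsometry.extend_apply]
    simp [L]
  rw [h1] at h2
  exact h2

theorem measure_nonisoBall_eq (u v : CSphere n) (r : ℝ) :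
    sphereMeasure n (nonisoBall u r) = sphereMeasure n (nonisoBall v r) := by
  obtain ⟨U, rfl⟩ := exists_sphereMap_eq u v
  rw [← (measurePreserving_sphereMap U).measure_preimage (s := nonisoBall (sphereMap U u) r)
    (measurableSet_nonisoBall _ _).nullMeasurableSet]
  congr 1
  ext z
  simp [nonisoBall, nonisoDist_sphereMap]

end Unitary

/-! ### Doubling -/

section Doubling

variable {n : ℕ}

/-- As |w| = 1, 1 - ⟨z, w⟩ = ⟨w - z, w⟩. Along u the difference is at most εr; orthogonally, a
difference ε√r meets a part of w of size at most √(2Kr). -/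
theorem nonisoDist_le_of_parts {u z w : CSphere n} {K r ε : ℝ} (hr : 0 < r)
    (hw : nonisoDist w u ≤ K * r)
    (h1 : ‖orthPart (u : Cn n) w - orthPart (u : Cn n) z‖ ≤ ε * √r)
    (h2 : ‖inner ℂ (u : Cn n) (w : Cn n) - inner ℂ (u : Cn n) (z : Cn n)‖ ≤ ε * r) :
    nonisoDist z w ≤ ε * (1 + √(2 * K)) * r := by
  have e : (1 : ℂ) - inner ℂ (w : Cn n) (z : Cn n) =
      (inner ℂ (u : Cn n) (w : Cn n) - inner ℂ (u : Cn n) (z : Cn n)) *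
        starRingEnd ℂ (inner ℂ (u : Cn n) (w : Cn n))
      + inner ℂ (orthPart (u : Cn n) w) (orthPart (u : Cn n) w - orthPart (u : Cn n) z) := by
    have h := inner_eq_add_inner_orthPart u.norm_eq (w : Cn n) (w : Cn n)
    rw [inner_self_eq_norm_sq_to_K, w.norm_eq] at h
    rw [inner_sub_right, inner_eq_add_inner_orthPart u.norm_eq (w : Cn n) (z : Cn n)]
    simp only [RCLike.ofReal_one, one_pow] at h
    linear_combination h
  have ho : ‖orthPart (u : Cn n) w‖ ≤ √(2 * K) * √r := by
    rw [← Real.sqrt_mul' _ hr.le]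
    refine Real.le_sqrt_of_sq_le ((norm_sq_orthPart_le u w).trans ?_)
    linarith
  have hc : ‖starRingEnd ℂ (inner ℂ (u : Cn n) (w : Cn n))‖ ≤ 1 := by
    rw [RCLike.norm_conj]
    exact CSphere.norm_inner_le_one u w
  have hεr : 0 ≤ ε * r := (norm_nonneg _).trans h2
  have hε : 0 ≤ ε := nonneg_of_mul_nonneg_left hεr hr
  rw [nonisoDist, e]
  refine (norm_add_le _ _).trans ?_
  have t1 := (norm_mul_le (inner ℂ (u : Cn n) (w : Cn n) - inner ℂ (u : Cn n) (z : Cn n))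
    (starRingEnd ℂ (inner ℂ (u : Cn n) (w : Cn n)))).trans
    (mul_le_mul h2 hc (norm_nonneg _) hεr)
  have t2 := (norm_inner_le_norm (𝕜 := ℂ) (orthPart (u : Cn n) w)
    (orthPart (u : Cn n) w - orthPart (u : Cn n) z)).trans
    (mul_le_mul ho h1 (norm_nonneg _) (by positivity))
  have hs := Real.mul_self_sqrt hr.le
  refine (add_le_add t1 t2).trans (le_of_eq ?_)
  linear_combination (ε * √(2 * K)) * hs

/-- The doubling property, uniformly in the centres. -/
theorem exists_measure_nonisoBall_le (n : ℕ) {K : ℝ} (hK : 0 ≤ K) : ∃ N : ℕ, ∀ r : ℝ, 0 < r →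
    ∀ u v : CSphere n, sphereMeasure n (nonisoBall u (K * r)) ≤
      N * sphereMeasure n (nonisoBall v r) := by
  -- Two points of one ε-ball differ by at most 2ε, and 2ε(1 + √(2K)) = 1.
  set ε : ℝ := (2 * (1 + √(2 * K)))⁻¹ with hε
  have hε0 : 0 < ε := by positivity
  obtain ⟨t, -, htf, ht⟩ := (isCompact_closedBall (0 : Cn n × ℂ) (√(2 * K) + K)).finite_cover_balls
    hε0
  refine ⟨htf.toFinset.card, fun r hr u v => ?_⟩
  have hsr : 0 < √r := Real.sqrt_pos.2 hr
  -- Anisotropic rescaling sends every ball of radius Kr into one fixed compact set, so the number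
  -- of pieces does not depend on r or u.
  let Ψ : CSphere n → Cn n × ℂ := fun z =>
    ((√r)⁻¹ • orthPart (u : Cn n) z, r⁻¹ • (1 - inner ℂ (u : Cn n) (z : Cn n)))
  let S : Cn n × ℂ → Set (CSphere n) := fun p => nonisoBall u (K * r) ∩ Ψ ⁻¹' ball p ε
  have hcover : nonisoBall u (K * r) ⊆ ⋃ p ∈ htf.toFinset, S p := by
    intro z hz
    have hz' : nonisoDist z u ≤ K * r := hz
    have : Ψ z ∈ closedBall (0 : Cn n × ℂ) (√(2 * K) + K) := by
      rw [mem_closedBall_zero_iff]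
      refine max_le ?_ ?_
      · rw [norm_smul, norm_inv, Real.norm_eq_abs, abs_of_pos hsr, inv_mul_le_iff₀ hsr]
        have : ‖orthPart (u : Cn n) z‖ ≤ √(2 * K) * √r := by
          rw [← Real.sqrt_mul' _ hr.le]
          refine Real.le_sqrt_of_sq_le ((norm_sq_orthPart_le u z).trans ?_)
          linarith
        nlinarith
      · rw [norm_smul, norm_inv, Real.norm_eq_abs, abs_of_pos hr, inv_mul_le_iff₀ hr]
        have : ‖1 - inner ℂ (u : Cn n) (z : Cn n)‖ ≤ K * r := hz'
        nlinarith [Real.sqrt_nonneg (2 * K)]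
    obtain ⟨p, hp, hpz⟩ := Set.mem_iUnion₂.1 (ht this)
    exact Set.mem_iUnion₂.2 ⟨p, htf.mem_toFinset.2 hp, hz, hpz⟩
  have hS : ∀ p, sphereMeasure n (S p) ≤ sphereMeasure n (nonisoBall v r) := by
    intro p
    rcases (S p).eq_empty_or_nonempty with h | ⟨w, hw⟩
    · simp [h]
    rw [measure_nonisoBall_eq v w r]
    refine measure_mono fun z hz => ?_
    have hd : dist (Ψ w) (Ψ z) ≤ 2 * ε := by
      have h1 := mem_ball.1 hw.2
      have h2 := mem_ball.1 hz.2
      have := dist_triangle_right (Ψ w) (Ψ z) p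
      linarith
    rw [Prod.dist_eq, max_le_iff] at hd
    have h1 : ‖orthPart (u : Cn n) w - orthPart (u : Cn n) z‖ ≤ 2 * ε * √r := by
      have := hd.1
      rwa [dist_eq_norm, ← smul_sub, norm_smul, norm_inv, Real.norm_eq_abs, abs_of_pos hsr,
        inv_mul_le_iff₀ hsr, mul_comm] at this
    have h2 : ‖inner ℂ (u : Cn n) (w : Cn n) - inner ℂ (u : Cn n) (z : Cn n)‖ ≤ 2 * ε * r := by
      have := hd.2
      rwa [dist_eq_norm, ← smul_sub, norm_smul, norm_inv, Real.norm_eq_abs, abs_of_pos hr,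
        inv_mul_le_iff₀ hr, mul_comm, sub_sub_sub_cancel_left, norm_sub_rev] at this
    refine (nonisoDist_le_of_parts hr hw.1 h1 h2).trans (le_of_eq ?_)
    rw [hε]
    field_simp
  calc sphereMeasure n (nonisoBall u (K * r))
      ≤ ∑ p ∈ htf.toFinset, sphereMeasure n (S p) :=
        (measure_mono hcover).trans (measure_biUnion_finset_le _ _)
    _ ≤ ∑ p ∈ htf.toFinset, sphereMeasure n (nonisoBall v r) := Finset.sum_le_sum fun p _ => hS p
    _ = _ := by simp

end Doubling

/-! ### Discs orthogonal to an axis -/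

section Rotation

variable {n : ℕ}

/-- Multiplication by `l` on the orthogonal complement of the unit vector `v`, and the identity on
the line of `v`. -/
noncomputable def orthScale (v : Cn n) (l : ℂ) (z : Cn n) : Cn n :=
  inner ℂ v z • v + l • orthPart v z

theorem inner_orthScale {v : Cn n} (hv : ‖v‖ = 1) (l : ℂ) (z : Cn n) :
    inner ℂ v (orthScale v l z) = inner ℂ v z := by
  rw [orthScale, inner_add_right, inner_smul_right, inner_smul_right, inner_orthPart hv,
    inner_self_eq_norm_sq_to_K, hv]
  simp

theorem norm_sq_orthScale {v : Cn n} (hv : ‖v‖ = 1) (l : ℂ) (z : Cn n) :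
    ‖orthScale v l z‖ ^ 2 = ‖inner ℂ v z‖ ^ 2 + ‖l‖ ^ 2 * ‖orthPart v z‖ ^ 2 := by
  rw [← norm_sq_add_norm_sq_orthPart hv, inner_orthScale hv, orthPart, inner_orthScale hv,
    orthScale, add_sub_cancel_left, norm_smul, mul_pow]

theorem orthScale_zero (v z : Cn n) : orthScale v 0 z = inner ℂ v z • v := by
  simp [orthScale]

/-- `orthScale` for unimodular `l`, as a unitary map. -/
noncomputable def orthRotation (v : CSphere n) (l : ℂ) (hl : ‖l‖ = 1) : Cn n ≃ₗᵢ[ℂ] Cn n :=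
  LinearIsometry.toLinearIsometryEquiv
    { toFun := orthScale v l
      map_add' := fun x y => by
        simp only [orthScale, orthPart, inner_add_right]
        module
      map_smul' := fun a x => by
        simp only [orthScale, orthPart, inner_smul_right, RingHom.id_apply]
        module
      norm_map' := fun x => by
        have h := norm_sq_orthScale v.norm_eq l x
        rw [hl, one_pow, one_mul, norm_sq_add_norm_sq_orthPart v.norm_eq] at h
        exact (sq_eq_sq₀ (norm_nonneg _) (norm_nonneg _)).1 h } rfl

theorem norm_orthScale_le_one (v : CSphere n) {l : ℂ} (hl : ‖l‖ ≤ 1) (z : CSphere n) :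
    ‖orthScale (v : Cn n) l z‖ ≤ 1 := by
  have h := norm_sq_orthScale v.norm_eq l (z : Cn n)
  have h2 := norm_sq_add_norm_sq_orthPart v.norm_eq (z : Cn n)
  rw [z.norm_eq] at h2
  have h3 : ‖l‖ ^ 2 ≤ 1 := pow_le_one₀ (norm_nonneg _) hl
  refine (sq_le_one_iff₀ (norm_nonneg _)).1 ?_
  nlinarith [sq_nonneg ‖orthPart (v : Cn n) z‖]

theorem norm_orthScale_lt_one (v : CSphere n) {l : ℂ} (hl : ‖l‖ < 1) {z : CSphere n}
    (hz : ‖inner ℂ (v : Cn n) (z : Cn n)‖ < 1) : ‖orthScale (v : Cn n) l z‖ < 1 := by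
  have h := norm_sq_orthScale v.norm_eq l (z : Cn n)
  have h2 := norm_sq_add_norm_sq_orthPart v.norm_eq (z : Cn n)
  rw [z.norm_eq] at h2
  have h3 : ‖l‖ ^ 2 < 1 := pow_lt_one₀ (norm_nonneg _) hl two_ne_zero
  have h4 : ‖inner ℂ (v : Cn n) (z : Cn n)‖ ^ 2 < 1 := pow_lt_one₀ (norm_nonneg _) hz two_ne_zero
  refine (sq_lt_one_iff₀ (norm_nonneg _)).1 ?_
  nlinarith

end Rotation

/-! ### Averaging the disc estimate over the sphere -/

namespace IsZeroFreeBallFunction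

variable {n : ℕ} {f : Cn n → ℂ}

theorem continuous_comp_sphere (hf : IsZeroFreeBallFunction f) : Continuous fun z : CSphere n => f z :=
  hf.continuous.comp_continuous continuous_subtype_val fun z => by simp

theorem continuous_comp_orthScale {X : Type*} [TopologicalSpace X] (hf : IsZeroFreeBallFunction f)
    (v : CSphere n) {l : X → ℂ} {z : X → CSphere n} (hl : Continuous l) (hl1 : ∀ x, ‖l x‖ ≤ 1)
    (hz : Continuous z) : Continuous fun x => f (orthScale (v : Cn n) (l x) (z x)) := by
  have h : Continuous fun x => orthScale (v : Cn n) (l x) (z x : Cn n) := by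
    have hz' : Continuous fun x => (z x : Cn n) := continuous_subtype_val.comp hz
    unfold orthScale orthPart
    fun_prop
  refine hf.continuous.comp_continuous h fun x => ?_
  exact mem_closedBall_zero_iff.2 (norm_orthScale_le_one v (hl1 x) (z x))

theorem diffContOnCl_orthScale (hf : IsZeroFreeBallFunction f) (v z : CSphere n)
    (hz : ‖inner ℂ (v : Cn n) (z : Cn n)‖ < 1) :
    DiffContOnCl ℂ (fun l => f (orthScale (v : Cn n) l z)) (ball 0 1) := by
  have hd : Differentiable ℂ fun l : ℂ => orthScale (v : Cn n) l z := by
    unfold orthScale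
    fun_prop
  refine ⟨hf.holomorphic.comp hd.differentiableOn fun l hl => ?_, ?_⟩
  · exact mem_ball_zero_iff.2 (norm_orthScale_lt_one v (mem_ball_zero_iff.1 hl) hz)
  · refine hf.continuous.comp hd.continuous.continuousOn fun l hl => ?_
    rw [closure_ball _ one_ne_zero, mem_closedBall_zero_iff] at hl
    exact mem_closedBall_zero_iff.2 (norm_orthScale_le_one v hl z)

theorem abs_norm_orthScale_sub_le {v z : CSphere n} {m η : ℝ}
    (hm : ∀ w : CSphere n, inner ℂ (v : Cn n) (w : Cn n) = inner ℂ (v : Cn n) (z : Cn n) →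
      |‖f w‖ - m| ≤ η) {l : ℂ} (hl : l ∈ sphere (0 : ℂ) 1) :
    |‖f (orthScale (v : Cn n) l z)‖ - m| ≤ η := by
  rw [mem_sphere_zero_iff_norm] at hl
  exact hm (sphereMap (orthRotation v l hl) z) (inner_orthScale v.norm_eq l z)

theorem orthScale_ne_zero (hf : IsZeroFreeBallFunction f) {v z : CSphere n}
    (hz : ‖inner ℂ (v : Cn n) (z : Cn n)‖ < 1) {l : ℂ} (hl : l ∈ ball (0 : ℂ) 1) :
    f (orthScale (v : Cn n) l z) ≠ 0 :=
  hf.ne_zero _ (mem_ball_zero_iff.2 (norm_orthScale_lt_one v (mem_ball_zero_iff.1 hl) hz))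

/-- On a set of circles in parallel complex lines, a zero-free function whose modulus is nearly
constant is close, in the mean, to its values at the centres of the circles. -/
theorem lintegral_enorm_sub_orthScale_zero_le (hf : IsZeroFreeBallFunction f) {v : CSphere n}
    {G : Set ℂ} (hG : MeasurableSet G) (hG1 : ∀ c ∈ G, ‖c‖ < 1) {m η κ : ℝ}
    (hm : ∀ w : CSphere n, inner ℂ (v : Cn n) (w : Cn n) ∈ G → |‖f w‖ - m| ≤ η)
    (hm0 : 0 ≤ m) (hη : 0 ≤ η) (hκ : 0 < κ) (hκ' : 4 * η * (m + η) ≤ κ ^ 2) :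
    ∫⁻ z in {z : CSphere n | inner ℂ (v : Cn n) (z : Cn n) ∈ G},
      ‖f z - f (orthScale (v : Cn n) 0 z)‖ₑ ∂sphereMeasure n ≤
    ENNReal.ofReal κ * sphereMeasure n {z : CSphere n | inner ℂ (v : Cn n) (z : Cn n) ∈ G} := by
  set A : Set (CSphere n) := {z : CSphere n | inner ℂ (v : Cn n) (z : Cn n) ∈ G} with hA
  have hAm : MeasurableSet A := by
    have : Measurable fun z : CSphere n => inner ℂ (v : Cn n) (z : Cn n) :=
      (by fun_prop : Continuous fun z : CSphere n => inner ℂ (v : Cn n) (z : Cn n)).measurable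
    exact this hG
  have hc0 : Continuous fun z : CSphere n => f (orthScale (v : Cn n) 0 z) :=
    hf.continuous_comp_orthScale v continuous_const (by simp) continuous_id
  have hc1 : Continuous fun p : ℝ × CSphere n => f (orthScale (v : Cn n) (circleMap 0 1 p.1) p.2) :=
    hf.continuous_comp_orthScale v ((continuous_circleMap 0 1).comp continuous_fst) (by simp)
      continuous_snd
  set F : CSphere n → ℝ≥0∞ := fun z => ‖f z - f (orthScale (v : Cn n) 0 z)‖ₑ with hF
  have hFm : Measurable F := (hf.continuous_comp_sphere.sub hc0).enorm.measurable
  set H : ℝ → CSphere n → ℝ≥0∞ := fun θ z =>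
    ‖f (orthScale (v : Cn n) (circleMap 0 1 θ) z) - f (orthScale (v : Cn n) 0 z)‖ₑ with hH
  have hHm : Measurable (Function.uncurry H) :=
    (hc1.sub (hc0.comp continuous_snd)).enorm.measurable
  -- Rotation by θ about v preserves the measure, the set A and the centre of each circle.
  have hinv : ∀ θ : ℝ, ∫⁻ z in A, H θ z ∂sphereMeasure n = ∫⁻ z in A, F z ∂sphereMeasure n := by
    intro θ
    have hl : ‖circleMap 0 1 θ‖ = 1 := by simp
    have hmp := measurePreserving_sphereMap (orthRotation v _ hl)
    have hpre : sphereMap (orthRotation v _ hl) ⁻¹' A = A := by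
      ext z
      change inner ℂ (v : Cn n) (orthScale (v : Cn n) _ z) ∈ G ↔ _
      rw [inner_orthScale v.norm_eq]
      rfl
    rw [← hmp.setLIntegral_comp_preimage hAm hFm, hpre]
    refine lintegral_congr fun z => ?_
    change _ = ‖f (orthScale (v : Cn n) _ z) - f (orthScale (v : Cn n) 0 (orthScale (v : Cn n) _ z))‖ₑ
    rw [orthScale_zero, inner_orthScale v.norm_eq, ← orthScale_zero]
  have hpt : ∀ z ∈ A, ∫⁻ θ in Set.Ioc 0 (2 * Real.pi), H θ z ≤ ENNReal.ofReal (2 * Real.pi * κ) := by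
    intro z hz
    have hz1 := hG1 _ hz
    have h := circleAverage_norm_sub_le one_pos (hf.diffContOnCl_orthScale v z hz1)
      (fun l hl => hf.orthScale_ne_zero hz1 hl)
      (fun l hl => abs_norm_orthScale_sub_le (fun w hw => hm w (hw ▸ hz)) hl) hm0 hη hκ hκ'
    have hc : Continuous fun θ : ℝ =>
        f (orthScale (v : Cn n) (circleMap 0 1 θ) z) - f (orthScale (v : Cn n) 0 z) :=
      (hf.continuous_comp_orthScale v (continuous_circleMap 0 1) (by simp) continuous_const).sub
        continuous_const
    have hi : IntegrableOn (fun θ : ℝ =>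
        f (orthScale (v : Cn n) (circleMap 0 1 θ) z) - f (orthScale (v : Cn n) 0 z))
        (Set.Ioc 0 (2 * Real.pi)) := hc.integrableOn_Ioc
    rw [← ofReal_integral_norm_eq_lintegral_enorm hi]
    refine ENNReal.ofReal_le_ofReal ?_
    rw [← intervalIntegral.integral_of_le Real.two_pi_pos.le]
    rw [Real.circleAverage, smul_eq_mul, inv_mul_le_iff₀ Real.two_pi_pos] at h
    exact h
  have hpi : ENNReal.ofReal (2 * Real.pi) ≠ 0 := by simp [Real.pi_pos]
  rw [← ENNReal.mul_le_mul_iff_right hpi ENNReal.ofReal_ne_top]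
  calc ENNReal.ofReal (2 * Real.pi) * ∫⁻ z in A, F z ∂sphereMeasure n
      = ∫⁻ θ in Set.Ioc 0 (2 * Real.pi), ∫⁻ z in A, H θ z ∂sphereMeasure n := by
        simp_rw [hinv]
        rw [lintegral_const, Measure.restrict_apply_univ, Real.volume_Ioc, sub_zero, mul_comm]
    _ = ∫⁻ z in A, (∫⁻ θ in Set.Ioc 0 (2 * Real.pi), H θ z) ∂sphereMeasure n :=
        lintegral_lintegral_swap hHm.aemeasurable
    _ ≤ ∫⁻ z in A, ENNReal.ofReal (2 * Real.pi * κ) ∂sphereMeasure n :=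
        setLIntegral_mono' hAm hpt
    _ = _ := by
        rw [setLIntegral_const, ENNReal.ofReal_mul Real.two_pi_pos.le, mul_assoc]

end IsZeroFreeBallFunction

/-! ### The slice constant: finiteness and the bound it gives -/

theorem EReal.abs_eq_toENNReal_add (x : EReal) : x.abs = x.toENNReal + (-x).toENNReal := by
  induction x with
  | bot => simp
  | top => simp
  | coe x =>
    rw [← EReal.coe_neg, EReal.abs_def, EReal.toENNReal_of_ne_top (EReal.coe_ne_top _),
      EReal.toENNReal_of_ne_top (EReal.coe_ne_top _), EReal.toReal_coe, EReal.toReal_coe]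
    rcases le_total 0 x with h | h
    · rw [abs_of_nonneg h, ENNReal.ofReal_of_nonpos (neg_nonpos.2 h), add_zero]
    · rw [abs_of_nonpos h, ENNReal.ofReal_of_nonpos h, zero_add]

/-- Continuity includes 0, where the value is ∞; boundary zeros are thereby admitted in the limit to
the unit circle. -/
theorem ENNReal.continuous_abs_log : Continuous fun x : ℝ≥0∞ => (ENNReal.log x).abs := by
  simp_rw [EReal.abs_eq_toENNReal_add]
  exact (EReal.continuous_toENNReal.comp ENNReal.continuous_log).add
    (EReal.continuous_toENNReal.comp (continuous_neg.comp ENNReal.continuous_log))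

theorem ENNReal.abs_log_enorm {z : ℂ} (hz : z ≠ 0) :
    (ENNReal.log ‖z‖ₑ).abs = ENNReal.ofReal |Real.log ‖z‖| := by
  rw [← ofReal_norm, ENNReal.log_ofReal_of_pos (norm_pos_iff.2 hz), EReal.abs_def]

/-- An upper bound for x makes |log x| controllable by -log x, whose circle averages are known. -/
theorem Real.abs_log_le_two_mul_log_sub {x M : ℝ} (hx : 0 < x) (hM : 1 ≤ M) (hxM : x ≤ M) :
    |Real.log x| ≤ 2 * Real.log M - Real.log x := by
  have h1 := Real.log_le_log hx hxM
  have h2 := Real.log_nonneg hM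
  rw [abs_le]
  constructor <;> linarith

section Slice

variable {g : ℂ → ℂ} {M : ℝ}

theorem circleAverage_log_norm_of_ne_zero (hg : DifferentiableOn ℂ g (ball 0 1))
    (h0 : ∀ z ∈ ball (0 : ℂ) 1, g z ≠ 0) {ρ : ℝ} (hρ : 0 < ρ) (hρ1 : ρ < 1) :
    Real.circleAverage (fun z => Real.log ‖g z‖) 0 ρ = Real.log ‖g 0‖ := by
  refine InnerProductSpace.HarmonicOnNhd.circleAverage_eq (f := fun z => Real.log ‖g z‖) ?_
  intro z hz
  have hz' : z ∈ ball (0 : ℂ) 1 := by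
    rw [abs_of_pos hρ] at hz
    exact closedBall_subset_ball hρ1 hz
  exact (hg.analyticAt (isOpen_ball.mem_nhds hz')).harmonicAt_log_norm (h0 z hz')

theorem lintegral_abs_log_circleMap_le (hg : DifferentiableOn ℂ g (ball 0 1))
    (h0 : ∀ z ∈ ball (0 : ℂ) 1, g z ≠ 0) (hM : 1 ≤ M) (hgM : ∀ z ∈ ball (0 : ℂ) 1, ‖g z‖ ≤ M)
    {ρ : ℝ} (hρ : 0 < ρ) (hρ1 : ρ < 1) :
    ∫⁻ θ in Set.Ioc (-Real.pi) Real.pi, (ENNReal.log ‖g (circleMap 0 ρ θ)‖ₑ).abs ≤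
      ENNReal.ofReal (2 * Real.pi * (2 * Real.log M - Real.log ‖g 0‖)) := by
  have hmem : ∀ θ, circleMap 0 ρ θ ∈ ball (0 : ℂ) 1 := fun θ => by
    simpa [abs_of_pos hρ] using hρ1
  have hcont : Continuous fun θ => Real.log ‖g (circleMap 0 ρ θ)‖ :=
    ((hg.continuousOn.comp_continuous (continuous_circleMap 0 ρ) hmem).norm).log
      fun θ => norm_ne_zero_iff.2 (h0 _ (hmem θ))
  set u : ℝ → ℝ := fun θ => 2 * Real.log M - Real.log ‖g (circleMap 0 ρ θ)‖ with hu
  have hucont : Continuous u := continuous_const.sub hcont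
  have hle : ∀ θ, |Real.log ‖g (circleMap 0 ρ θ)‖| ≤ u θ := fun θ =>
    Real.abs_log_le_two_mul_log_sub (norm_pos_iff.2 (h0 _ (hmem θ))) hM (hgM _ (hmem θ))
  have hper : Function.Periodic u (2 * Real.pi) := fun θ => by
    simp only [hu, (periodic_circleMap 0 ρ) θ]
  have hint : ∫ θ in Set.Ioc (-Real.pi) Real.pi, u θ =
      2 * Real.pi * (2 * Real.log M - Real.log ‖g 0‖) := by
    rw [← intervalIntegral.integral_of_le (by linarith [Real.pi_pos])]
    have h1 := hper.intervalIntegral_add_eq (-Real.pi) 0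
    rw [show -Real.pi + 2 * Real.pi = Real.pi by ring, zero_add] at h1
    have h2 := circleAverage_log_norm_of_ne_zero hg h0 hρ hρ1
    rw [Real.circleAverage, smul_eq_mul, inv_mul_eq_iff_eq_mul₀ Real.two_pi_pos.ne'] at h2
    rw [h1, hu, intervalIntegral.integral_sub (by simp) (hcont.intervalIntegrable _ _), h2]
    simp only [intervalIntegral.integral_const, smul_eq_mul]
    ring
  rw [← hint, ofReal_integral_eq_lintegral_ofReal hucont.integrableOn_Ioc
    (Filter.Eventually.of_forall fun θ => (abs_nonneg _).trans (hle θ))]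
  refine lintegral_mono fun θ => ?_
  rw [ENNReal.abs_log_enorm (h0 _ (hmem θ))]
  exact ENNReal.ofReal_le_ofReal (hle θ)

/-- Jensen's inequality on the unit circle, for a zero-free function of the disc algebra. -/
theorem lintegral_abs_log_circle_le (hg : DifferentiableOn ℂ g (ball 0 1))
    (hgc : ContinuousOn g (closedBall 0 1))
    (h0 : ∀ z ∈ ball (0 : ℂ) 1, g z ≠ 0) (hM : 1 ≤ M) (hgM : ∀ z ∈ ball (0 : ℂ) 1, ‖g z‖ ≤ M) :
    ∫⁻ θ in Set.Ioc (-Real.pi) Real.pi, (ENNReal.log ‖g (circleMap 0 1 θ)‖ₑ).abs ≤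
      ENNReal.ofReal (2 * Real.pi * (2 * Real.log M - Real.log ‖g 0‖)) := by
  -- The shift by 2 keeps the first radius positive.
  let ρ : ℕ → ℝ := fun k => 1 - 1 / ((k : ℝ) + 2)
  have hρ0 : ∀ k, 0 < ρ k := fun k => by
    have : (1 : ℝ) / ((k : ℝ) + 2) < 1 := by
      rw [div_lt_one (by positivity)]
      linarith [k.cast_nonneg (α := ℝ)]
    simpa [ρ] using this
  have hρ1 : ∀ k, ρ k < 1 := fun k => by
    have : (0 : ℝ) < 1 / ((k : ℝ) + 2) := by positivity
    simpa [ρ] using this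
  have hρl : Filter.Tendsto ρ Filter.atTop (nhds 1) := by
    have h : Filter.Tendsto (fun k : ℕ => 1 / ((k : ℝ) + 2)) Filter.atTop (nhds 0) :=
      tendsto_const_nhds.div_atTop
        (Filter.tendsto_atTop_add_const_right _ (2 : ℝ) tendsto_natCast_atTop_atTop)
    simpa only [sub_zero] using (tendsto_const_nhds (x := (1 : ℝ))).sub h
  have hmem : ∀ k θ, circleMap 0 (ρ k) θ ∈ closedBall (0 : ℂ) 1 := fun k θ => by
    simpa [abs_of_pos (hρ0 k)] using (hρ1 k).le
  have hlim : ∀ θ, Filter.Tendsto (fun k => (ENNReal.log ‖g (circleMap 0 (ρ k) θ)‖ₑ).abs)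
      Filter.atTop (nhds (ENNReal.log ‖g (circleMap 0 1 θ)‖ₑ).abs) := by
    intro θ
    have h1 : Filter.Tendsto (fun k => circleMap 0 (ρ k) θ) Filter.atTop
        (nhdsWithin (circleMap 0 1 θ) (closedBall 0 1)) := by
      refine tendsto_nhdsWithin_iff.2 ⟨?_, Filter.Eventually.of_forall fun k => hmem k θ⟩
      have : Continuous fun s : ℝ => circleMap 0 s θ := by
        unfold circleMap
        fun_prop
      exact this.tendsto 1 |>.comp hρl
    have h2 := (hgc (circleMap 0 1 θ) (by simp)).tendsto.comp h1
    exact (ENNReal.continuous_abs_log.tendsto _).comp (h2.enorm)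
  -- Fatou's lemma, since the radial limits may be infinite.
  calc ∫⁻ θ in Set.Ioc (-Real.pi) Real.pi, (ENNReal.log ‖g (circleMap 0 1 θ)‖ₑ).abs
      = ∫⁻ θ in Set.Ioc (-Real.pi) Real.pi,
          Filter.liminf (fun k => (ENNReal.log ‖g (circleMap 0 (ρ k) θ)‖ₑ).abs) Filter.atTop :=
        lintegral_congr fun θ => (hlim θ).liminf_eq.symm
    _ ≤ Filter.liminf (fun k => ∫⁻ θ in Set.Ioc (-Real.pi) Real.pi,
          (ENNReal.log ‖g (circleMap 0 (ρ k) θ)‖ₑ).abs) Filter.atTop := by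
        refine lintegral_liminf_le fun k => ?_
        exact (ENNReal.continuous_abs_log.comp
          (hgc.comp_continuous (continuous_circleMap 0 (ρ k)) (hmem k)).enorm).measurable
    _ ≤ _ := by
        refine Filter.liminf_le_of_le (by isBoundedDefault) fun b hb => ?_
        obtain ⟨k, hk⟩ := hb.exists
        exact hk.trans (lintegral_abs_log_circleMap_le hg h0 hM hgM (hρ0 k) (hρ1 k))

end Slice

namespace IsZeroFreeBallFunction

variable {n : ℕ} {f : Cn n → ℂ}

theorem sliceConst_lt_top (hf : IsZeroFreeBallFunction f) : sliceConst f < ∞ := by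
  obtain ⟨M, hM⟩ := (isCompact_closedBall (0 : Cn n) 1).exists_bound_of_continuousOn hf.continuous
  refine lt_of_le_of_lt (iSup_le fun ξ => ?_)
    (ENNReal.ofReal_lt_top (r := 2 * Real.pi * (2 * Real.log (max M 1) - Real.log ‖f 0‖)))
  have hn : ∀ l : ℂ, ‖l • (ξ : Cn n)‖ = ‖l‖ := fun l => by rw [norm_smul, ξ.norm_eq, mul_one]
  have hmaps : Set.MapsTo (fun l : ℂ => l • (ξ : Cn n)) (ball 0 1) (ball 0 1) := fun l hl => by
    rw [mem_ball_zero_iff] at hl ⊢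
    rwa [hn]
  have hmapsc : Set.MapsTo (fun l : ℂ => l • (ξ : Cn n)) (closedBall 0 1) (closedBall 0 1) :=
    fun l hl => by
      rw [mem_closedBall_zero_iff] at hl ⊢
      rwa [hn]
  have hd : Differentiable ℂ fun l : ℂ => l • (ξ : Cn n) := by fun_prop
  have h := lintegral_abs_log_circle_le (g := fun l => f (l • (ξ : Cn n)))
    (hf.holomorphic.comp hd.differentiableOn hmaps)
    (hf.continuous.comp hd.continuous.continuousOn hmapsc)
    (fun l hl => hf.ne_zero _ (hmaps hl)) (le_max_right M 1)
    (fun l hl => (hM _ (ball_subset_closedBall (hmaps hl))).trans (le_max_left M 1))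
  simpa [circleMap] using h

/-- If |f| ≥ q > exp(B₀) on the whole sphere, a single slice integral is at least 2π log q > B₀. -/
theorem le_exp_of_sliceConst_le {B₀ : ℝ≥0} (hB : sliceConst f ≤ B₀) (ξ : CSphere n) {q : ℝ}
    (hq : ∀ z : CSphere n, q ≤ ‖f z‖) : q ≤ Real.exp B₀ := by
  by_contra! h
  have hq0 : 0 < q := (Real.exp_pos _).trans h
  have hlog : (B₀ : ℝ) < Real.log q := (Real.lt_log_iff_exp_lt hq0).2 h
  have hlog0 : 0 < Real.log q := B₀.coe_nonneg.trans_lt hlog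
  have h1 : ∫⁻ _ in Set.Ioc (-Real.pi) Real.pi, ENNReal.ofReal (Real.log q) ≤ B₀ := by
    refine le_trans (lintegral_mono fun θ => ?_) ((le_iSup (fun ξ : CSphere n =>
      ∫⁻ θ in Set.Ioc (-Real.pi) Real.pi,
        (ENNReal.log ‖f (Complex.exp (θ * Complex.I) • (ξ : Cn n))‖ₑ).abs) ξ).trans hB)
    have hz := hq ⟨Complex.exp (θ * Complex.I) • (ξ : Cn n), by
      simp [norm_smul, Complex.norm_exp_ofReal_mul_I]⟩
    rw [ENNReal.abs_log_enorm (norm_pos_iff.1 (hq0.trans_le hz))]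
    exact ENNReal.ofReal_le_ofReal ((Real.log_le_log hq0 hz).trans (le_abs_self _))
  rw [setLIntegral_const, Real.volume_Ioc, ← ENNReal.ofReal_mul hlog0.le,
    ← ENNReal.ofReal_coe_nnreal, ENNReal.ofReal_le_ofReal_iff B₀.coe_nonneg] at h1
  nlinarith [Real.pi_gt_three]

end IsZeroFreeBallFunction

/-! ### Orthogonal directions and the tilted axis -/

section Orthogonal

variable {n : ℕ}

theorem exists_sphere_inner_eq_zero (hn : 2 ≤ n) (v : CSphere n) :
    ∃ u : CSphere n, inner ℂ (v : Cn n) (u : Cn n) = 0 := by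
  have hne : (Submodule.span ℂ {(v : Cn n)})ᗮ ≠ ⊥ := by
    intro h
    have h1 := Submodule.finrank_add_finrank_orthogonal (Submodule.span ℂ {(v : Cn n)})
    rw [h, finrank_bot, finrank_euclideanSpace_fin] at h1
    have h2 := finrank_span_singleton (K := ℂ) (norm_pos_iff.1 (v.norm_eq ▸ one_pos))
    omega
  obtain ⟨w, hw, hw0⟩ := Submodule.exists_mem_ne_zero_of_ne_bot hne
  refine ⟨⟨((‖w‖⁻¹ : ℝ) : ℂ) • w, ?_⟩, ?_⟩
  · rw [mem_sphere_zero_iff_norm, norm_smul, Complex.norm_real, norm_inv, norm_norm,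
      inv_mul_cancel₀ (norm_ne_zero_iff.2 hw0)]
  · rw [inner_smul_right, Submodule.mem_orthogonal_singleton_iff_inner_right.1 hw, mul_zero]

theorem norm_add_smul_eq_one {v u : CSphere n} (huv : inner ℂ (v : Cn n) (u : Cn n) = 0) {a b : ℂ}
    (hab : ‖a‖ ^ 2 + ‖b‖ ^ 2 = 1) : ‖a • (v : Cn n) + b • (u : Cn n)‖ = 1 := by
  have h : inner ℂ (a • (v : Cn n)) (b • (u : Cn n)) = 0 := by
    rw [inner_smul_left, inner_smul_right, huv, mul_zero, mul_zero]
  have h2 := norm_add_sq_eq_norm_sq_add_norm_sq_of_inner_eq_zero _ _ h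
  rw [norm_smul, norm_smul, v.norm_eq, u.norm_eq] at h2
  nlinarith [norm_nonneg (a • (v : Cn n) + b • (u : Cn n))]

theorem exists_sphere_inner_eq (hn : 2 ≤ n) (v : CSphere n) {c : ℂ} (hc : ‖c‖ ≤ 1) :
    ∃ z : CSphere n, inner ℂ (v : Cn n) (z : Cn n) = c := by
  obtain ⟨u, hu⟩ := exists_sphere_inner_eq_zero hn v
  refine ⟨⟨c • (v : Cn n) + ((√(1 - ‖c‖ ^ 2) : ℝ) : ℂ) • (u : Cn n), ?_⟩, ?_⟩
  · rw [mem_sphere_zero_iff_norm]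
    refine norm_add_smul_eq_one hu ?_
    rw [Complex.norm_real, Real.norm_eq_abs, sq_abs, Real.sq_sqrt]
    · ring
    · have := pow_le_one₀ (norm_nonneg c) hc (n := 2)
      linarith
  · rw [inner_add_right, inner_smul_right, inner_smul_right, hu, inner_self_eq_norm_sq_to_K,
      v.norm_eq]
    simp

/-- A direction close to `e` such that the points near `e` stay away from the axis of that
direction. -/
theorem exists_tilted_axis (hn : 2 ≤ n) (e : CSphere n) {r : ℝ} (hr : 0 < r) (hr' : r ≤ 1 / 64) :
    ∃ v : CSphere n, nonisoDist v e ≤ 64 * r ∧ ∀ z : CSphere n, nonisoDist z e ≤ 4 * r →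
      ‖inner ℂ (v : Cn n) (z : Cn n)‖ ^ 2 ≤ 1 - r := by
  obtain ⟨u, hu⟩ := exists_sphere_inner_eq_zero hn e
  set s := √r with hs
  have hs2 : s ^ 2 = r := Real.sq_sqrt hr.le
  have hs0 : 0 < s := Real.sqrt_pos.2 hr
  -- With t the unit vector orthogonal to v in the plane of e and u, |⟨z, t⟩| ≥ 8s · 15/16 - 3s ≥ s.
  -- Hence z has a part of length at least √r orthogonal to v, while d(v, e) = 1 - a ≤ 1 - a² = 64r.
  set b := 8 * s with hb
  set a := √(1 - 64 * r) with ha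
  have ha2 : a ^ 2 = 1 - 64 * r := Real.sq_sqrt (by linarith)
  have ha0 : 0 ≤ a := Real.sqrt_nonneg _
  have ha1 : a ≤ 1 := by nlinarith
  have hb2 : b ^ 2 = 64 * r := by rw [hb, mul_pow, hs2]; norm_num
  have hue : inner ℂ (u : Cn n) (e : Cn n) = 0 := inner_eq_zero_symm.1 hu
  have hv1 : ‖(a : ℂ) • (e : Cn n) + (b : ℂ) • (u : Cn n)‖ = 1 := by
    refine norm_add_smul_eq_one hu ?_
    rw [Complex.norm_real, Complex.norm_real, Real.norm_eq_abs, Real.norm_eq_abs, sq_abs, sq_abs]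
    linarith
  have ht1 : ‖(((-b : ℝ)) : ℂ) • (e : Cn n) + (a : ℂ) • (u : Cn n)‖ = 1 := by
    refine norm_add_smul_eq_one hu ?_
    rw [Complex.norm_real, Complex.norm_real, Real.norm_eq_abs, Real.norm_eq_abs, sq_abs, sq_abs]
    linarith
  have hee : inner ℂ (e : Cn n) (e : Cn n) = 1 := by
    rw [inner_self_eq_norm_sq_to_K, e.norm_eq]; simp
  have huu : inner ℂ (u : Cn n) (u : Cn n) = 1 := by
    rw [inner_self_eq_norm_sq_to_K, u.norm_eq]; simp
  refine ⟨⟨_, mem_sphere_zero_iff_norm.2 hv1⟩, ?_, fun z hz => ?_⟩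
  · have : nonisoDist ⟨_, mem_sphere_zero_iff_norm.2 hv1⟩ e = ‖((1 - a : ℝ) : ℂ)‖ := by
      simp [nonisoDist, hu]
    rw [this, Complex.norm_real, Real.norm_eq_abs, abs_of_nonneg (by linarith)]
    nlinarith
  · set v : Cn n := (a : ℂ) • (e : Cn n) + (b : ℂ) • (u : Cn n) with hv
    set t : Cn n := (((-b : ℝ)) : ℂ) • (e : Cn n) + (a : ℂ) • (u : Cn n) with ht
    change ‖inner ℂ v (z : Cn n)‖ ^ 2 ≤ 1 - r
    have htv : inner ℂ t v = 0 := by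
      simp only [hv, ht, inner_add_left, inner_add_right, inner_smul_left, inner_smul_right, hu,
        hue, hee, huu, Complex.conj_ofReal]
      push_cast
      ring
    have h1 := norm_sq_add_norm_sq_orthPart hv1 (z : Cn n)
    rw [z.norm_eq] at h1
    have h2 : ‖inner ℂ t (z : Cn n)‖ ≤ ‖orthPart v z‖ := by
      have h3 := norm_inner_le_norm (𝕜 := ℂ) t (orthPart v z)
      rw [ht1, one_mul] at h3
      refine le_trans (le_of_eq ?_) h3
      rw [orthPart, inner_sub_right, inner_smul_right, htv, mul_zero, sub_zero]
    have h4 : inner ℂ t (z : Cn n) =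
        (a : ℂ) * inner ℂ (u : Cn n) (z : Cn n) - (b : ℂ) * inner ℂ (e : Cn n) (z : Cn n) := by
      simp only [ht, inner_add_left, inner_smul_left, Complex.conj_ofReal]
      push_cast
      ring
    have h5 : ‖inner ℂ (u : Cn n) (z : Cn n)‖ ≤ 3 * s := by
      have h6 := norm_inner_le_norm (𝕜 := ℂ) (u : Cn n) (orthPart (e : Cn n) z)
      rw [u.norm_eq, one_mul, orthPart, inner_sub_right, inner_smul_right, hue, mul_zero,
        sub_zero] at h6
      have h7 := norm_sq_orthPart_le e z
      refine h6.trans (abs_le_of_sq_le_sq' ?_ (by positivity)).2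
      rw [mul_pow, hs2]
      linarith
    have h8 : 15 / 16 ≤ ‖inner ℂ (e : Cn n) (z : Cn n)‖ := by
      have h9 := norm_sub_norm_le (1 : ℂ) (inner ℂ (e : Cn n) (z : Cn n))
      rw [norm_one] at h9
      have : ‖(1 : ℂ) - inner ℂ (e : Cn n) (z : Cn n)‖ ≤ 4 * r := hz
      linarith
    have h10 : s ≤ ‖inner ℂ t (z : Cn n)‖ := by
      rw [h4]
      have h11 := norm_sub_norm_le ((b : ℂ) * inner ℂ (e : Cn n) (z : Cn n))
        ((a : ℂ) * inner ℂ (u : Cn n) (z : Cn n))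
      rw [norm_mul, norm_mul, Complex.norm_real, Complex.norm_real, Real.norm_eq_abs,
        Real.norm_eq_abs, abs_of_nonneg ha0, abs_of_nonneg (by positivity : 0 ≤ b),
        norm_sub_rev] at h11
      have h12 : a * ‖inner ℂ (u : Cn n) (z : Cn n)‖ ≤ 3 * s :=
        (mul_le_of_le_one_left (norm_nonneg _) ha1).trans h5
      nlinarith
    nlinarith [norm_nonneg (orthPart v z)]

end Orthogonal

/-! ### Oscillation on a small ball -/

namespace IsZeroFreeBallFunction

variable {n : ℕ} {f : Cn n → ℂ}

/-- The point cv is the centre of a disc whose boundary circle lies on the sphere over c; the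
maximum and minimum principles carry the bound inward. -/
theorem abs_norm_smul_sub_le (hf : IsZeroFreeBallFunction f) (hn : 2 ≤ n) {v : CSphere n} {c : ℂ}
    {m η : ℝ} (hc : ‖c‖ < 1)
    (hm : ∀ w : CSphere n, inner ℂ (v : Cn n) (w : Cn n) = c → |‖f w‖ - m| ≤ η) :
    |‖f (c • (v : Cn n))‖ - m| ≤ η := by
  obtain ⟨z, rfl⟩ := exists_sphere_inner_eq hn v hc.le
  have h := norm_mem_Icc_of_sphere one_pos (hf.diffContOnCl_orthScale v z hc)
    (fun l hl => hf.orthScale_ne_zero hc hl) (fun l hl => abs_norm_orthScale_sub_le hm hl)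
    (mem_closedBall_self zero_le_one)
  rw [orthScale_zero] at h
  rw [abs_le]
  constructor <;> linarith [h.1, h.2]

theorem norm_sub_smul_le (hf : IsZeroFreeBallFunction f) (hn : 2 ≤ n) {v : CSphere n} {G : Set ℂ}
    (hG : Convex ℝ G) {ρ m η κ : ℝ} (hρ : 0 < ρ)
    (hG1 : ∀ c ∈ G, ∀ c' ∈ closedBall c ρ, ‖c'‖ < 1)
    (hm : ∀ c ∈ G, ∀ c' ∈ closedBall c ρ, ∀ w : CSphere n, inner ℂ (v : Cn n) (w : Cn n) = c' →
      |‖f w‖ - m| ≤ η)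
    (hm0 : 0 ≤ m) (hη : 0 ≤ η) (hκ : 0 < κ) (hκ' : 4 * η * (m + η) ≤ κ ^ 2)
    {c₁ c₂ : ℂ} (h₁ : c₁ ∈ G) (h₂ : c₂ ∈ G) :
    ‖f (c₂ • (v : Cn n)) - f (c₁ • (v : Cn n))‖ ≤ κ / ρ * ‖c₂ - c₁‖ := by
  have hmaps : Set.MapsTo (fun l : ℂ => l • (v : Cn n)) (ball 0 1) (ball 0 1) := fun l hl => by
    rw [mem_ball_zero_iff] at hl ⊢
    rwa [norm_smul, v.norm_eq, mul_one]
  have hd : DifferentiableOn ℂ (fun l : ℂ => f (l • (v : Cn n))) (ball 0 1) :=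
    hf.holomorphic.comp (by fun_prop) hmaps
  have hsub : ∀ c ∈ G, closedBall c ρ ⊆ ball 0 1 := fun c hc c' hc' =>
    mem_ball_zero_iff.2 (hG1 c hc c' hc')
  refine hG.norm_image_sub_le_of_norm_deriv_le (𝕜 := ℂ) (f := fun l : ℂ => f (l • (v : Cn n)))
    (fun c hc => hd.differentiableAt (isOpen_ball.mem_nhds (hsub c hc (mem_closedBall_self hρ.le))))
    (fun c hc => ?_) h₁ h₂
  have hdc : DiffContOnCl ℂ (fun l : ℂ => f (l • (v : Cn n))) (ball c ρ) :=
    (hd.mono (by rw [closure_ball c hρ.ne']; exact hsub c hc)).diffContOnCl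
  refine norm_deriv_center_le hρ hdc (fun z hz => ?_) (fun z hz => ?_) hm0 hη hκ hκ'
  · exact hf.ne_zero _ (hmaps (hsub c hc (ball_subset_closedBall hz)))
  · have hz' := sphere_subset_closedBall hz
    exact hf.abs_norm_smul_sub_le hn (hG1 c hc z hz') (hm c hc z hz')

end IsZeroFreeBallFunction

theorem meanOsc_le_of_lintegral_le {n : ℕ} {f : CSphere n → ℂ} (hf : Continuous f)
    {Q : Set (CSphere n)} {a : ℂ} {b : ℝ} (hb : 0 ≤ b)
    (h : ∫⁻ z in Q, ‖f z - a‖ₑ ∂sphereMeasure n ≤ ENNReal.ofReal b * sphereMeasure n Q) :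
    meanOsc f Q ≤ b := by
  have hbdd : BddBelow (Set.range fun a : ℂ => ⨍ z in Q, ‖f z - a‖ ∂(sphereMeasure n)) := by
    refine ⟨0, ?_⟩
    rintro _ ⟨a, rfl⟩
    exact integral_nonneg fun z => norm_nonneg _
  refine (ciInf_le hbdd a).trans ?_
  rw [setAverage_eq, smul_eq_mul]
  have hint : ∫ z in Q, ‖f z - a‖ ∂sphereMeasure n ≤ b * (sphereMeasure n).real Q := by
    have hm : AEStronglyMeasurable (fun z => f z - a) ((sphereMeasure n).restrict Q) :=
      (hf.sub continuous_const).aestronglyMeasurable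
    rw [integral_norm_eq_lintegral_enorm hm]
    refine (ENNReal.toReal_mono (ENNReal.mul_ne_top ENNReal.ofReal_ne_top (measure_ne_top _ _))
      h).trans (le_of_eq ?_)
    rw [ENNReal.toReal_mul, ENNReal.toReal_ofReal hb, measureReal_def]
  -- On a null set the average is 0 by convention.
  rcases eq_or_lt_of_le (measureReal_nonneg (μ := sphereMeasure n) (s := Q)) with h0 | h0
  · rw [← h0, inv_zero, zero_mul]
    exact hb
  · rw [inv_mul_le_iff₀ h0, mul_comm]
    exact hint

namespace IsZeroFreeBallFunction

variable {n : ℕ} {f : Cn n → ℂ}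

theorem meanOsc_le (hf : IsZeroFreeBallFunction f) (hn : 2 ≤ n) {N : ℕ} {e ξ : CSphere n} {r : ℝ}
    (hr : 0 < r) (hr' : r ≤ 1 / 64)
    (hN : ∀ u v : CSphere n, sphereMeasure n (nonisoBall u (136 * r)) ≤
      N * sphereMeasure n (nonisoBall v r))
    (he : e ∈ nonisoBall ξ r) {m η κ : ℝ}
    (hm : ∀ w : CSphere n, nonisoDist w e ≤ 402 * r → |‖f w‖ - m| ≤ η)
    (hm0 : 0 ≤ m) (hη : 0 ≤ η) (hκ : 0 < κ) (hκ' : 4 * η * (m + η) ≤ κ ^ 2) :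
    meanOsc (fun z : CSphere n => f z) (nonisoBall ξ r) ≤ (N + 1088) * κ := by
  obtain ⟨v, hve, hv⟩ := exists_tilted_axis hn e hr hr'
  set Q := nonisoBall ξ r with hQ
  -- The centres, as coordinates along v. Points of Q satisfy d(z, e) ≤ 2(r + r) = 4r, hence d(z, v)
  -- ≤ 2(4r + 64r) = 136r.
  set G : Set ℂ := {c | ‖c‖ ≤ √(1 - r)} ∩ {c | ‖1 - c‖ ≤ 136 * r} with hG
  have hGc : Convex ℝ G := by
    have h1 : {c : ℂ | ‖c‖ ≤ √(1 - r)} = closedBall 0 √(1 - r) := by ext; simp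
    have h2 : {c : ℂ | ‖1 - c‖ ≤ 136 * r} = closedBall 1 (136 * r) := by
      ext c; simp [dist_eq_norm, norm_sub_rev]
    rw [hG, h1, h2]
    exact (convex_closedBall _ _).inter (convex_closedBall _ _)
  have hGm : MeasurableSet G :=
    ((isClosed_le (by fun_prop) (by fun_prop)).inter
      (isClosed_le (by fun_prop) (by fun_prop))).measurableSet
  have hsqrt : √(1 - r) ≤ 1 - r / 2 := by
    refine Real.sqrt_le_iff.2 ⟨by linarith, by nlinarith⟩
  -- The gap 1 - √(1 - r) ≥ r/2 leaves room for discs of radius r/4.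
  have hG1 : ∀ c ∈ G, ∀ c' ∈ closedBall c (r / 4), ‖c'‖ < 1 := by
    intro c hc c' hc'
    rw [mem_closedBall, dist_eq_norm] at hc'
    have h1 := norm_sub_norm_le c' c
    have h2 : ‖c‖ ≤ √(1 - r) := hc.1
    linarith
  have hGm' : ∀ c ∈ G, ∀ c' ∈ closedBall c (r / 4), ∀ w : CSphere n,
      inner ℂ (v : Cn n) (w : Cn n) = c' → |‖f w‖ - m| ≤ η := by
    -- The quasi-triangle inequality gives 2(136r + r/4 + 64r) ≤ 402r.
    intro c hc c' hc' w hw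
    refine hm w ((nonisoDist_le_two_mul_add w v e).trans ?_)
    have h1 : nonisoDist w v = ‖1 - c'‖ := by rw [nonisoDist, hw]
    rw [mem_closedBall, dist_eq_norm] at hc'
    have h2 : ‖1 - c‖ ≤ 136 * r := hc.2
    have h3 := norm_sub_le (1 - c) (c' - c)
    rw [sub_sub_sub_cancel_right] at h3
    linarith
  have hGself : ∀ c ∈ G, c ∈ closedBall c (r / 4) := fun c _ =>
    mem_closedBall_self (by positivity)
  set A : Set (CSphere n) := {z | inner ℂ (v : Cn n) (z : Cn n) ∈ G} with hA
  have hAmem : ∀ z : CSphere n, nonisoDist z e ≤ 4 * r → inner ℂ (v : Cn n) (z : Cn n) ∈ G := by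
    intro z hz
    refine ⟨Real.le_sqrt_of_sq_le (hv z hz), ?_⟩
    have h := nonisoDist_le_two_mul_add z e v
    rw [nonisoDist_comm e v] at h
    exact h.trans (by linarith)
  have hQA : ∀ z ∈ Q, inner ℂ (v : Cn n) (z : Cn n) ∈ G := by
    intro z hz
    refine hAmem z ((nonisoDist_le_two_mul_add z ξ e).trans ?_)
    have h1 : nonisoDist z ξ ≤ r := hz
    have h2 : nonisoDist e ξ ≤ r := he
    rw [nonisoDist_comm ξ e]
    linarith
  have heG : inner ℂ (v : Cn n) (e : Cn n) ∈ G := hQA e he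
  have hAle : sphereMeasure n A ≤ N * sphereMeasure n Q :=
    (measure_mono fun z hz => hz.2).trans (hN v ξ)
  have hQm : MeasurableSet Q := measurableSet_nonisoBall ξ r
  refine meanOsc_le_of_lintegral_le hf.continuous_comp_sphere
    (a := f (inner ℂ (v : Cn n) (e : Cn n) • (v : Cn n))) (by positivity) ?_
  have hpt : ∀ z ∈ Q, ‖f z - f (inner ℂ (v : Cn n) (e : Cn n) • (v : Cn n))‖ₑ ≤
      ‖f z - f (orthScale (v : Cn n) 0 z)‖ₑ + ENNReal.ofReal (1088 * κ) := by
    intro z hz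
    have h1 := hf.norm_sub_smul_le hn hGc (by positivity : 0 < r / 4) hG1 hGm' hm0 hη hκ hκ' heG
      (hQA z hz)
    have h2 : ‖inner ℂ (v : Cn n) (z : Cn n) - inner ℂ (v : Cn n) (e : Cn n)‖ ≤ 272 * r := by
      have h3 := norm_sub_le (1 - inner ℂ (v : Cn n) (e : Cn n)) (1 - inner ℂ (v : Cn n) (z : Cn n))
      rw [sub_sub_sub_cancel_left] at h3
      have h4 : ‖1 - inner ℂ (v : Cn n) (e : Cn n)‖ ≤ 136 * r := heG.2
      have h5 : ‖1 - inner ℂ (v : Cn n) (z : Cn n)‖ ≤ 136 * r := (hQA z hz).2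
      linarith
    -- The diameter bound 272r times the derivative bound 4κ/r gives 1088κ.
    have h6 : κ / (r / 4) * ‖inner ℂ (v : Cn n) (z : Cn n) - inner ℂ (v : Cn n) (e : Cn n)‖ ≤
        1088 * κ := by
      refine (mul_le_mul_of_nonneg_left h2 (by positivity)).trans (le_of_eq ?_)
      field_simp
      ring
    have h7 := h1.trans h6
    rw [← orthScale_zero (v : Cn n) (z : Cn n)] at h7
    rw [← sub_add_sub_cancel (f z) (f (orthScale (v : Cn n) 0 z))]
    refine (enorm_add_le _ _).trans (add_le_add le_rfl ?_)
    rw [← ofReal_norm]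
    exact ENNReal.ofReal_le_ofReal h7
  calc ∫⁻ z in Q, ‖f z - f (inner ℂ (v : Cn n) (e : Cn n) • (v : Cn n))‖ₑ ∂sphereMeasure n
      ≤ ∫⁻ z in Q, (‖f z - f (orthScale (v : Cn n) 0 z)‖ₑ + ENNReal.ofReal (1088 * κ))
          ∂sphereMeasure n := setLIntegral_mono' hQm hpt
    _ = ∫⁻ z in Q, ‖f z - f (orthScale (v : Cn n) 0 z)‖ₑ ∂sphereMeasure n
          + ENNReal.ofReal (1088 * κ) * sphereMeasure n Q := by
        rw [lintegral_add_right _ measurable_const, setLIntegral_const]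
    _ ≤ ENNReal.ofReal κ * sphereMeasure n A + ENNReal.ofReal (1088 * κ) * sphereMeasure n Q := by
        gcongr
        refine (lintegral_mono_set hQA).trans ?_
        exact hf.lintegral_enorm_sub_orthScale_zero_le hGm
          (fun c hc => hG1 c hc c (hGself c hc))
          (fun w hw => hGm' _ hw _ (hGself _ hw) w rfl) hm0 hη hκ hκ'
    _ ≤ ENNReal.ofReal κ * (N * sphereMeasure n Q)
          + ENNReal.ofReal (1088 * κ) * sphereMeasure n Q := by gcongr
    _ = _ := by
        rw [add_mul, ENNReal.ofReal_add (by positivity) (by positivity),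
          ENNReal.ofReal_mul (Nat.cast_nonneg N), ENNReal.ofReal_natCast]
        ring

end IsZeroFreeBallFunction

/-! ### Choice of constants -/

theorem mainTheorem1 (n : ℕ) [NeZero n] (hn : 2 ≤ n) (α : ℝ) (hα₀ : 0 < α) (hα₁ : α < 1) :
    (∀ f : Cn n → ℂ, IsZeroFreeBallFunction f → sliceConst f < ∞) ∧
    ∀ (B₀ : ℝ≥0) (C₀ : ℝ), ∃ C : ℝ, ∀ f : Cn n → ℂ,
      IsZeroFreeBallFunction f →
      sliceConst f ≤ B₀ →
      (∀ t : CSphere n, |‖f t‖ - ‖f (basePoint n)‖| ≤ C₀ * nonisoDist t (basePoint n) ^ α) →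
      ∀ (ξ : CSphere n) (r : ℝ), 0 < r → basePoint n ∈ nonisoBall ξ r →
        meanOsc (fun z : CSphere n => f z) (nonisoBall ξ r) ≤ C * r ^ (α / 2) := by
  refine ⟨fun f hf => hf.sliceConst_lt_top, fun B₀ C₀ => ?_⟩
  obtain ⟨N, hN⟩ := exists_measure_nonisoBall_le n (by norm_num : (0 : ℝ) ≤ 136)
  set L := |C₀| with hL
  have hL0 : 0 ≤ L := abs_nonneg C₀
  set M := Real.exp B₀ + 2 * L with hM
  have hM0 : 0 < M := by positivity
  -- With η = 402Lr^α and κ = Dr^(α/2), 4η(m + η) ≤ (D - 1)r^α ≤ κ²; the added 1 also keeps κ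
  -- positive when L = 0.
  set D := 1608 * L * (M + 402 * L) + 1 with hD
  have hD1 : 1 ≤ D := by
    have : 0 ≤ 1608 * L * (M + 402 * L) := by positivity
    linarith
  refine ⟨max ((N + 1088) * D) (64 * (M + 2 * L)), fun f hf hB hmod ξ r hr he => ?_⟩
  set e := basePoint n with he'
  have hbound : ∀ {R : ℝ}, 1 ≤ R → ∀ {s : ℝ}, 0 ≤ s → ∀ t : CSphere n, nonisoDist t e ≤ R * s →
      |‖f t‖ - ‖f e‖| ≤ R * L * s ^ α := by
    intro R hR s hs t ht
    have h1 : nonisoDist t e ^ α ≤ (R * s) ^ α :=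
      Real.rpow_le_rpow (nonisoDist_nonneg _ _) ht hα₀.le
    have h2 : R ^ α ≤ R := by
      simpa using Real.rpow_le_rpow_of_exponent_le hR hα₁.le
    rw [Real.mul_rpow (by linarith) hs] at h1
    calc |‖f t‖ - ‖f e‖| ≤ C₀ * nonisoDist t e ^ α := hmod t
      _ ≤ L * nonisoDist t e ^ α :=
        mul_le_mul_of_nonneg_right (le_abs_self _) (Real.rpow_nonneg (nonisoDist_nonneg _ _) _)
      _ ≤ L * (R ^ α * s ^ α) := by gcongr
      _ ≤ L * (R * s ^ α) := by gcongr
      _ = _ := by ring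
  have hglob : ∀ t : CSphere n, |‖f t‖ - ‖f e‖| ≤ 2 * L := fun t => by
    simpa using hbound one_le_two zero_le_one t (by simpa using nonisoDist_le_two t e)
  -- Distances are at most 2, so |f| ≥ |f(e)| - 2L on the whole sphere, and the slice constant
  -- bounds that minimum.
  have hmM : ‖f e‖ ≤ M := by
    have := IsZeroFreeBallFunction.le_exp_of_sliceConst_le hB e (q := ‖f e‖ - 2 * L) fun z => by
      linarith [(abs_le.1 (hglob z)).1]
    linarith
  rcases le_or_gt r (1 / 64) with hr' | hr'
  · have hrα : r ^ α ≤ 1 := Real.rpow_le_one hr.le (by linarith) hα₀.le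
    have hrα0 : 0 < r ^ α := Real.rpow_pos_of_pos hr α
    have hsq : (r ^ (α / 2)) ^ 2 = r ^ α := by
      rw [← Real.rpow_natCast, ← Real.rpow_mul hr.le]
      norm_num
    have h := hf.meanOsc_le hn hr hr' (hN r hr) he (m := ‖f e‖) (η := 402 * L * r ^ α)
      (κ := D * r ^ (α / 2)) (fun w hw => hbound (by norm_num) hr.le w hw) (norm_nonneg _)
      (by positivity) (by positivity) ?_
    · refine h.trans ?_
      rw [← mul_assoc]
      gcongr
      exact le_max_left _ _
    · rw [mul_pow, hsq]
      calc 4 * (402 * L * r ^ α) * (‖f e‖ + 402 * L * r ^ α)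
          ≤ 4 * (402 * L * r ^ α) * (M + 402 * L * 1) := by gcongr
        _ = (D - 1) * r ^ α := by rw [hD]; ring
        _ ≤ D ^ 2 * r ^ α := by gcongr; nlinarith
  -- For large r the bound |f| ≤ M + 2L suffices, as r^(α/2) is bounded below.
  · have hlow : 1 / 64 ≤ r ^ (α / 2) := by
      calc (1 / 64 : ℝ) = (1 / 64) ^ (1 : ℝ) := (Real.rpow_one _).symm
        _ ≤ (1 / 64) ^ (α / 2) :=
          Real.rpow_le_rpow_of_exponent_ge (by norm_num) (by norm_num) (by linarith)
        _ ≤ r ^ (α / 2) := Real.rpow_le_rpow (by norm_num) hr'.le (by linarith)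
    have h : meanOsc (fun z : CSphere n => f z) (nonisoBall ξ r) ≤ M + 2 * L := by
      refine meanOsc_le_of_lintegral_le hf.continuous_comp_sphere (a := 0) (by positivity) ?_
      rw [← setLIntegral_const]
      refine lintegral_mono fun z => ?_
      rw [sub_zero, ← ofReal_norm]
      exact ENNReal.ofReal_le_ofReal (by linarith [(abs_le.1 (hglob z)).2])
    calc meanOsc (fun z : CSphere n => f z) (nonisoBall ξ r) ≤ M + 2 * L := h
      _ ≤ 64 * (M + 2 * L) * r ^ (α / 2) := by
        have : 0 ≤ M + 2 * L := by positivity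
        nlinarith
      _ ≤ _ := by
        gcongr
        exact le_max_right _ _
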